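/- Let $d>0$, $\alpha\in(0,1)$, $\theta\in(0,1)$, $c_M\ge1$, $c_G\ge1$ and $C_1>0$. There is a constant $C_2>0$, depending only on $(d,\alpha,\theta,c_M,c_G,C_1)$, such that for every $R_0\ge1$ there is a constant $R_1>R_0$, depending only on $R_0$ and on the constants above, for which the following holds. Let $G=(V,E_V)$ be a locally finite connected graph with graph distance $\rho$ and balls $B(x,r)=\{y\in V:\rho(x,y)\le r\}$, let $r_G\in[1,\infty]$, and let $\mu$ be a measure on $V$ with $c_M^{-1}\le\mu_x:=\mu(\{x\})\le c_M$ for all $x\in V$ and $c_G^{-1}r^d\le\mu(B(x,r))\le c_Gr^d$ for all $x\in V$ and $1\le r<r_G$. Let $w_{x,y}=w_{y,x}\ge0$ $(x,y\in V)$ be weights with $w_{x,x}=0$ and $\sum_{y\in V}\frac{w_{x,y}}{\rho(x,y)^{d+\alpha}}\mu_y<\infty$ for all $x\in V$ (with $0/0=0$). Let $X=((X_t)_{t\ge0},(\mathbb P_x)_{x\in V})$ be the associated variable speed random walk: under $\mathbb P_x$ it starts at $X_0=x$; at a vertex $z$ it waits for an exponentially distributed time of parameter $C_z=\sum_{y}C_{z,y}\mu_y$,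 where $C_{z,y}=w_{z,y}/\rho(z,y)^{d+\alpha}$, and then jumps to $y$ with probability $C_{z,y}\mu_y/C_z$ (it stays at $z$ forever if $C_z=0$), the procedure being iterated independently; after a possible explosion it is sent to a cemetery outside $V$. For $A\subset V$ let $\tau_A=\inf\{t>0:X_t\notin A\}$. Let $0\in V$ be a fixed vertex, and assume that for every $R_0<R<r_G$ $$\sup_{x\in B(0,6R)}\ \sum_{y\in V:\rho(x,y)\le r}\frac{w_{x,y}}{\rho(x,y)^{d+\alpha-1}}\le C_1r^{1-\alpha}\qquad\text{for all } \tfrac12R^\theta\le r\le2R,$$ $$\sup_{x\in B(0,6R)}\ \sum_{y\in V:\rho(x,y)>r}\frac{w_{x,y}}{\rho(x,y)^{d+\alpha}}\le C_1r^{-\alpha}\qquad\text{for all } r\ge\tfrac12R^\theta.$$ Then for all $R_1<R<r_G$, $x\in B(0,2R)$, $R^\theta\le r\le R$ and $t>0$, $$\mathbb P_x\big(\tau_{B(x,r)}\le t\big)\le\frac{C_2\,t}{r^{\alpha}}.$$ -/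

import Mathlib

open MeasureTheory ProbabilityTheory
open scoped ENNReal NNReal

noncomputable section

namespace StableLike

/-! ### Continuous-time Markov chains with given jump rates -/

section Chain

variable {V : Type*} [MeasurableSpace V] [DiscreteMeasurableSpace V]

/-- Joint law of the holding time at `x` and of the next state, for jump rates `q`.
With `q x = ∑' y, q x y`: the holding time is exponential with parameter `q x`, and, independently,
the next state is `y` with probability `q x y / q x`. A state with `q x = 0` is absorbing (infinite
holding time). The case `q x = ∞` is given the same default value; it does not occur below. -/
def stepLaw (q : V → V → ℝ≥0∞) (x : V) : Measure (ℝ≥0∞ × V) :=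
  open Classical in
  if h : (∑' y, q x y) ≠ 0 ∧ (∑' y, q x y) ≠ ∞ then
    ((expMeasure (∑' y, q x y).toReal).map ENNReal.ofReal).prod
      (PMF.normalize (q x) h.1 h.2).toMeasure
  else Measure.dirac (∞, x)

instance isProbabilityMeasure_stepLaw (q : V → V → ℝ≥0∞) (x : V) :
    IsProbabilityMeasure (stepLaw q x) := by
  unfold stepLaw
  split_ifs with h
  · have h1 : IsProbabilityMeasure (expMeasure (∑' y, q x y).toReal) :=
      isProbabilityMeasure_expMeasure (ENNReal.toReal_pos h.1 h.2)
    have h2 : IsProbabilityMeasure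
        ((expMeasure (∑' y, q x y).toReal).map ENNReal.ofReal) :=
      Measure.isProbabilityMeasure_map ENNReal.measurable_ofReal.aemeasurable
    infer_instance
  · infer_instance

/-- The step law as a Markov kernel. -/
def stepKernel (q : V → V → ℝ≥0∞) : Kernel V (ℝ≥0∞ × V) where
  toFun := stepLaw q
  measurable' := Measurable.of_discrete

instance isMarkovKernel_stepKernel (q : V → V → ℝ≥0∞) : IsMarkovKernel (stepKernel q) :=
  ⟨fun x => isProbabilityMeasure_stepLaw q x⟩

/-- The transition from the history up to step `n` to step `n + 1`: it depends on the history only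
through the current state. -/
def historyKernel (q : V → V → ℝ≥0∞) (n : ℕ) :
    Kernel (Π _ : Finset.Iic n, ℝ≥0∞ × V) (ℝ≥0∞ × V) :=
  (stepKernel q).comap (fun h => (h ⟨n, Finset.mem_Iic.2 le_rfl⟩).2) (by fun_prop)

instance isMarkovKernel_historyKernel (q : V → V → ℝ≥0∞) (n : ℕ) :
    IsMarkovKernel (historyKernel q n) := by
  unfold historyKernel
  infer_instance

/-- `ℙ_x`: the law of the sequence `((0, Y₀), (S₁, Y₁), (S₂, Y₂), …)` with `Y₀ = x`, where `Yₙ` is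
the state after the `n`-th jump and `Sₙ₊₁` is the holding time at `Yₙ`. -/
def chainLaw (q : V → V → ℝ≥0∞) (x : V) : Measure (ℕ → ℝ≥0∞ × V) :=
  Kernel.traj (X := fun _ => ℝ≥0∞ × V) (historyKernel q) 0 (fun _ => (0, x))

/-- The time `S₁ + ⋯ + Sₙ` of the `n`-th jump. -/
def jumpTime (ω : ℕ → ℝ≥0∞ × V) (n : ℕ) : ℝ≥0∞ :=
  ∑ k ∈ Finset.range n, (ω (k + 1)).1

/-- The process `X_t`: it sits at `Yₙ` for times between the `n`-th and the `(n+1)`-st jump. After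
all jump times (i.e. after an explosion) it is in the cemetery `none`. -/
def path (ω : ℕ → ℝ≥0∞ × V) (t : ℝ≥0) : Option V :=
  open Classical in
  if ∃ n, (t : ℝ≥0∞) < jumpTime ω (n + 1) then
    some (ω (sInf {n : ℕ | (t : ℝ≥0∞) < jumpTime ω (n + 1)})).2
  else none

/-- The exit time `τ_A = inf {t > 0 : X_t ∉ A}` (the cemetery lies outside every `A ⊆ V`). -/
def exitTime (A : Set V) (ω : ℕ → ℝ≥0∞ × V) : ℝ≥0∞ :=
  ⨅ (t : ℝ≥0) (_ : 0 < t) (_ : path ω t ∉ some '' A), (t : ℝ≥0∞)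

end Chain

/-! ### Stable-like chains on graphs -/

/-- The closed ball `B(x,r)` for the graph distance. -/
def ball {V : Type*} (G : SimpleGraph V) (x : V) (r : ℝ) : Set V :=
  {y | (G.dist x y : ℝ) ≤ r}

/-- A locally finite connected graph with a measure `μ`, which is bounded above and below on points
and satisfies the `d`-set condition up to scale `rG`, and with symmetric weights `w` such that
`∑_y w_{x,y} ρ(x,y)^{-(d+α)} μ_y` is finite for each `x`. -/
structure WeightedGraph (V : Type*) [MeasurableSpace V] (d α cM cG : ℝ) (rG : EReal) where
  /-- the graph -/
  G : SimpleGraph V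
  /-- the measure on the vertices -/
  μ : Measure V
  /-- the weights -/
  w : V → V → ℝ
  finite_neighborSet : ∀ x, (G.neighborSet x).Finite
  connected : G.Connected
  le_mass : ∀ x, ENNReal.ofReal cM⁻¹ ≤ μ {x}
  mass_le : ∀ x, μ {x} ≤ ENNReal.ofReal cM
  le_volume : ∀ (x : V) (r : ℝ), 1 ≤ r → (r : EReal) < rG →
    ENNReal.ofReal (cG⁻¹ * r ^ d) ≤ μ (ball G x r)
  volume_le : ∀ (x : V) (r : ℝ), 1 ≤ r → (r : EReal) < rG →
    μ (ball G x r) ≤ ENNReal.ofReal (cG * r ^ d)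
  w_self : ∀ x, w x x = 0
  w_nonneg : ∀ x y, 0 ≤ w x y
  w_symm : ∀ x y, w x y = w y x
  sum_ne_top : ∀ x,
    ∑' y, ENNReal.ofReal (w x y / (G.dist x y : ℝ) ^ (d + α)) * μ {y} ≠ ∞

namespace WeightedGraph

variable {V : Type*} [MeasurableSpace V] {d α cM cG : ℝ} {rG : EReal}

/-- The jump rate `C_{x,y} μ_y` from `x` to `y`, with `C_{x,y} = w_{x,y} / ρ(x,y)^{d+α}`. -/
def rate (Γ : WeightedGraph V d α cM cG rG) (x y : V) : ℝ≥0∞ :=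
  ENNReal.ofReal (Γ.w x y / (Γ.G.dist x y : ℝ) ^ (d + α)) * Γ.μ {y}

/-- `∑_{y : ρ(x,y) ≤ r} w_{x,y} / ρ(x,y)^{d+α-1}`. -/
def firstMoment (Γ : WeightedGraph V d α cM cG rG) (x : V) (r : ℝ) : ℝ≥0∞ :=
  ∑' y : {y : V | (Γ.G.dist x y : ℝ) ≤ r},
    ENNReal.ofReal (Γ.w x y / (Γ.G.dist x y : ℝ) ^ (d + α - 1))

/-- `∑_{y : ρ(x,y) > r} w_{x,y} / ρ(x,y)^{d+α}`. -/
def tail (Γ : WeightedGraph V d α cM cG rG) (x : V) (r : ℝ) : ℝ≥0∞ :=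
  ∑' y : {y : V | r < (Γ.G.dist x y : ℝ)},
    ENNReal.ofReal (Γ.w x y / (Γ.G.dist x y : ℝ) ^ (d + α))

end WeightedGraph

end StableLike

end

/-! Run the chain with killing at rate `l = 1/t` and use the barrier `g(y) = min(ρ(x,y)/r, 1) + K t`
on `A = B(x,r)`. By the triangle inequality, the generator applied to the truncated distance is, at
`z ∈ A`, at most the mean truncated jump size from `z`. Jumps of length at most `r` contribute `r⁻¹`
times the first moment, longer ones the tail, so `K = 2 c_M C₁ r^{-α}` is a bound. Since `K = l · K
t ≤ l g`, the function `g` is superharmonic for the killed chain in `A`, and `g ≥ 1` outside.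
Optional stopping gives `E_x[exp(-τ/t)] ≤ g(x) = K t`, and Markov's inequality bounds the exit
probability.

Optional stopping is carried out on the jump chain (`lintegral_exitDiscount_superharmonic_le`). Jump
rates in `A` are bounded, so the discounted mass surviving `n` jumps inside `A` decays
geometrically, which disposes of explosions (`chainLaw_exitTime_lt_le`). -/

namespace StableLike

/-! ### Exponential discounting of holding times -/

section Laplace

/-- The function `s ↦ exp (-l * s)` on `[0, ∞]`, with value `0` at `∞`. -/
noncomputable def expNeg (l : ℝ) (s : ℝ≥0∞) : ℝ≥0∞ :=
  open Classical in if s = ∞ then 0 else ENNReal.ofReal (Real.exp (-(l * s.toReal)))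

lemma measurable_expNeg (l : ℝ) : Measurable (expNeg l) := by
  unfold expNeg
  refine Measurable.ite (measurableSet_singleton _) measurable_const ?_
  fun_prop

lemma expNeg_top (l : ℝ) : expNeg l ∞ = 0 := by simp [expNeg]

lemma expNeg_of_ne_top {l : ℝ} {s : ℝ≥0∞} (hs : s ≠ ∞) :
    expNeg l s = ENNReal.ofReal (Real.exp (-(l * s.toReal))) := by simp [expNeg, hs]

lemma expNeg_zero (l : ℝ) : expNeg l 0 = 1 := by simp [expNeg]

lemma expNeg_antitone {l : ℝ} (hl : 0 ≤ l) : Antitone (expNeg l) := by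
  intro a b hab
  by_cases hb : b = ∞
  · simp [hb, expNeg_top]
  have ha : a ≠ ∞ := ne_top_of_le_ne_top hb hab
  rw [expNeg_of_ne_top ha, expNeg_of_ne_top hb]
  have := ENNReal.toReal_mono hb hab
  gcongr

lemma expNeg_add (l : ℝ) (a b : ℝ≥0∞) : expNeg l (a + b) = expNeg l a * expNeg l b := by
  by_cases ha : a = ∞
  · simp [ha, expNeg_top]
  by_cases hb : b = ∞
  · simp [hb, expNeg_top]
  rw [expNeg_of_ne_top ha, expNeg_of_ne_top hb, expNeg_of_ne_top (by simp [ha, hb]),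
    ENNReal.toReal_add ha hb, ← ENNReal.ofReal_mul (Real.exp_nonneg _), ← Real.exp_add]
  ring_nf

/-- The Laplace transform of the exponential distribution. -/
lemma lintegral_expNeg_expMeasure {l r : ℝ} (hl : 0 < l) (hr : 0 < r) :
    ∫⁻ s, expNeg l (ENNReal.ofReal s) ∂(expMeasure r) = ENNReal.ofReal (r / (l + r)) := by
  have hm : Measurable fun s => expNeg l (ENNReal.ofReal s) :=
    (measurable_expNeg l).comp ENNReal.measurable_ofReal
  have hpdf (a : ℝ) : Measurable (exponentialPDF a) :=
    (measurable_exponentialPDFReal a).ennreal_ofReal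
  have hmeas : expMeasure r = volume.withDensity (exponentialPDF r) := rfl
  rw [hmeas, lintegral_withDensity_eq_lintegral_mul _ (hpdf r) hm]
  -- Discounting tilts the density of rate `r` into a multiple of the density of rate `l + r`.
  have key : ∀ s, (exponentialPDF r * fun s => expNeg l (ENNReal.ofReal s)) s
      = ENNReal.ofReal (r / (l + r)) * exponentialPDF (l + r) s := by
    intro s
    rw [Pi.mul_apply]
    by_cases hs : 0 ≤ s
    · rw [exponentialPDF_of_nonneg hs, exponentialPDF_of_nonneg hs,
        expNeg_of_ne_top ENNReal.ofReal_ne_top, ENNReal.toReal_ofReal hs,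
        ← ENNReal.ofReal_mul (by positivity), ← ENNReal.ofReal_mul (by positivity)]
      congr 1
      have : Real.exp (-((l + r) * s)) = Real.exp (-(r * s)) * Real.exp (-(l * s)) := by
        rw [← Real.exp_add]; ring_nf
      rw [this]
      field_simp
    · rw [exponentialPDF_of_neg (not_le.1 hs), exponentialPDF_of_neg (not_le.1 hs)]
      simp
  simp_rw [key]
  rw [lintegral_const_mul _ (hpdf _), lintegral_exponentialPDF_eq_one (by positivity), mul_one]

end Laplace

/-! ### One-step expectations and the Markov property -/

section Chain

variable {V : Type*} [MeasurableSpace V] [DiscreteMeasurableSpace V]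

lemma lintegral_pmf (p : PMF V) (h : V → ℝ≥0∞) :
    ∫⁻ y, h y ∂p.toMeasure = ∑' y, p y * h y := by
  have : p.toMeasure = Measure.sum fun y => p y • Measure.dirac y := by
    ext s hs
    rw [PMF.toMeasure_apply _ hs, Measure.sum_apply _ hs]
    refine tsum_congr fun y => ?_
    by_cases hy : y ∈ s <;> simp [hy, Measure.dirac_apply' _ hs]
  rw [this, lintegral_sum_measure]
  refine tsum_congr fun y => ?_
  rw [lintegral_smul_measure, lintegral_dirac' _ Measurable.of_discrete, smul_eq_mul]

/-- The discounted expectation of a function of the next state. -/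
lemma lintegral_stepLaw {q : V → V → ℝ≥0∞} {z : V} (hq : ∑' y, q z y ≠ ∞) {l : ℝ} (hl : 0 < l)
    (h : V → ℝ≥0∞) :
    ∫⁻ p, expNeg l p.1 * h p.2 ∂(stepLaw q z)
      = (∑' y, q z y * h y) / (ENNReal.ofReal l + ∑' y, q z y) := by
  by_cases h0 : ∑' y, q z y = 0
  · have hz : ∀ y, q z y = 0 := ENNReal.tsum_eq_zero.1 h0
    have hm : Measurable fun p : ℝ≥0∞ × V => expNeg l p.1 * h p.2 :=
      ((measurable_expNeg l).comp measurable_fst).mul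
        ((Measurable.of_discrete (f := h)).comp measurable_snd)
    -- An absorbing state has infinite holding time, hence discount `0`; the right side is `0 / l`.
    rw [stepLaw, dif_neg (by simp [h0]), lintegral_dirac' _ hm]
    simp [expNeg_top, hz]
  · have hpos : 0 < (∑' y, q z y).toReal := ENNReal.toReal_pos h0 hq
    have := isProbabilityMeasure_expMeasure hpos
    have : IsProbabilityMeasure
        ((expMeasure (∑' y, q z y).toReal).map ENNReal.ofReal) :=
      Measure.isProbabilityMeasure_map ENNReal.measurable_ofReal.aemeasurable
    rw [stepLaw, dif_pos ⟨h0, hq⟩,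
      lintegral_prod_mul (measurable_expNeg l).aemeasurable
        (Measurable.of_discrete (f := h)).aemeasurable,
      lintegral_map (measurable_expNeg l) ENNReal.measurable_ofReal,
      lintegral_expNeg_expMeasure hl hpos, lintegral_pmf]
    simp only [PMF.normalize_apply]
    rw [ENNReal.ofReal_div_of_pos (by positivity), ENNReal.ofReal_add hl.le hpos.le,
      ENNReal.ofReal_toReal hq]
    have : ∀ y, q z y * (∑' x, q z x)⁻¹ * h y = (∑' x, q z x)⁻¹ * (q z y * h y) := by
      intro y; ring
    simp_rw [this]
    rw [ENNReal.tsum_mul_left, div_eq_mul_inv, div_eq_mul_inv]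
    calc _ = ((∑' x, q z x) * (∑' x, q z x)⁻¹) * (∑' x, q z x * h x)
          * (ENNReal.ofReal l + ∑' x, q z x)⁻¹ := by ring
      _ = _ := by rw [ENNReal.mul_inv_cancel h0 hq, one_mul]

instance isProbabilityMeasure_chainLaw (q : V → V → ℝ≥0∞) (x : V) :
    IsProbabilityMeasure (chainLaw q x) := by
  unfold chainLaw
  infer_instance

/-- The Markov property at step `n`. -/
lemma lintegral_chainLaw_mul {q : V → V → ℝ≥0∞} {x : V} {n : ℕ}
    {F : (ℕ → ℝ≥0∞ × V) → ℝ≥0∞} (hF : Measurable F)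
    (hdep : ∀ ω, F ω = F fun i => ω (min i n)) {H : ℝ≥0∞ × V → ℝ≥0∞} (hH : Measurable H) :
    ∫⁻ ω, F ω * H (ω (n + 1)) ∂(chainLaw q x)
      = ∫⁻ ω, F ω * ∫⁻ p, H p ∂(stepLaw q (ω n).2) ∂(chainLaw q x) := by
  -- A history up to `n` is extended by freezing its last entry; `hdep` says that `F` sees only this
  -- extension.
  let e : (Π _ : Finset.Iic n, ℝ≥0∞ × V) → ℕ → ℝ≥0∞ × V :=
    fun h i => h ⟨min i n, Finset.mem_Iic.2 (min_le_right _ _)⟩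
  have he : Measurable e := by fun_prop
  have key := Kernel.partialTraj_compProd_eq_map_traj (X := fun _ => ℝ≥0∞ × V)
    (κ := historyKernel q) (Nat.zero_le n) (x₀ := fun _ => (0, x))
  have e1 : ∫⁻ ω, F ω * H (ω (n + 1)) ∂(chainLaw q x)
      = ∫⁻ p, F (e p.1) * H p.2 ∂((chainLaw q x).map
          fun ω => (Preorder.frestrictLe (π := fun _ => ℝ≥0∞ × V) n ω, ω (n + 1))) := by
    rw [lintegral_map (by fun_prop) (by fun_prop)]
    exact lintegral_congr fun ω => by rw [hdep]; rfl
  have e2 : ∫⁻ ω, F ω * ∫⁻ p, H p ∂(stepLaw q (ω n).2) ∂(chainLaw q x)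
      = ∫⁻ h, F (e h) * ∫⁻ p, H p ∂(historyKernel q n h) ∂((chainLaw q x).map
          (Preorder.frestrictLe (π := fun _ => ℝ≥0∞ × V) n)) := by
    have hm : Measurable fun h => F (e h) * ∫⁻ p, H p ∂(historyKernel q n h) :=
      (hF.comp he).mul hH.lintegral_kernel
    rw [lintegral_map hm (by fun_prop)]
    exact lintegral_congr fun ω => by rw [hdep]; rfl
  rw [e1, e2]
  unfold chainLaw
  rw [← key, Kernel.traj_map_frestrictLe_apply, Measure.lintegral_compProd (by fun_prop)]
  refine lintegral_congr fun h => ?_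
  exact lintegral_const_mul (F (e h)) hH

lemma ae_chainLaw_zero (q : V → V → ℝ≥0∞) (x : V) : ∀ᵐ ω ∂(chainLaw q x), (ω 0).2 = x := by
  have h : (chainLaw q x).map (Preorder.frestrictLe (π := fun _ => ℝ≥0∞ × V) 0)
      = Measure.dirac fun _ => (0, x) := by
    unfold chainLaw
    rw [Kernel.traj_map_frestrictLe_apply, Kernel.partialTraj_self, Kernel.id_apply]
  have hm : MeasurableSet {p : Π _ : Finset.Iic 0, ℝ≥0∞ × V | (p ⟨0, by simp⟩).2 = x} :=
    (by fun_prop : Measurable fun p : Π _ : Finset.Iic 0, ℝ≥0∞ × V => (p ⟨0, _⟩).2)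
      (measurableSet_singleton x)
  have h2 : ∀ᵐ p ∂((chainLaw q x).map (Preorder.frestrictLe (π := fun _ => ℝ≥0∞ × V) 0)),
      (p ⟨0, by simp⟩).2 = x := by
    rw [h, ae_dirac_iff hm]
  exact ae_of_ae_map (by fun_prop) h2

end Chain

/-! ### Optional stopping for the discounted jump chain -/

section ExitTime

variable {V : Type*}

/-- The discount factor of the first `n` jumps, killed if one of them starts outside `A`. -/
noncomputable def discount (A : Set V) (l : ℝ) (ω : ℕ → ℝ≥0∞ × V) (n : ℕ) : ℝ≥0∞ :=
  ∏ j ∈ Finset.range n, (A.indicator 1 (ω j).2 * expNeg l (ω (j + 1)).1)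

lemma discount_zero (A : Set V) (l : ℝ) (ω : ℕ → ℝ≥0∞ × V) : discount A l ω 0 = 1 := by
  simp [discount]

lemma discount_succ (A : Set V) (l : ℝ) (ω : ℕ → ℝ≥0∞ × V) (n : ℕ) :
    discount A l ω (n + 1)
      = discount A l ω n * (A.indicator 1 (ω n).2 * expNeg l (ω (n + 1)).1) := by
  simp [discount, Finset.prod_range_succ]

lemma discount_eq_expNeg_jumpTime {A : Set V} {l : ℝ} {ω : ℕ → ℝ≥0∞ × V} {n : ℕ}
    (h : ∀ j < n, (ω j).2 ∈ A) : discount A l ω n = expNeg l (jumpTime ω n) := by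
  induction n with
  | zero => simp [discount_zero, jumpTime, expNeg_zero]
  | succ n ih =>
    have hT : jumpTime ω (n + 1) = jumpTime ω n + (ω (n + 1)).1 := Finset.sum_range_succ _ _
    rw [discount_succ, ih fun j hj => h j (by lia), hT, expNeg_add,
      Set.indicator_of_mem (h n (by lia)), Pi.one_apply, one_mul]

lemma jumpTime_mono (ω : ℕ → ℝ≥0∞ × V) : Monotone (jumpTime ω) := fun _ _ h =>
  Finset.sum_le_sum_of_subset (Finset.range_mono h)

lemma discount_eq_min (A : Set V) (l : ℝ) (ω : ℕ → ℝ≥0∞ × V) {m n : ℕ} (h : m ≤ n) :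
    discount A l ω m = discount A l (fun i => ω (min i n)) m := by
  refine Finset.prod_congr rfl fun j hj => ?_
  have := Finset.mem_range.1 hj
  beta_reduce
  rw [min_eq_left (by lia : j ≤ n), min_eq_left (by lia : j + 1 ≤ n)]

/-- The discounted payoff `1` at the first exit from `A`, or at the `n`-th jump if this comes
first. -/
noncomputable def exitDiscount (A : Set V) (l : ℝ) (ω : ℕ → ℝ≥0∞ × V) (n : ℕ) : ℝ≥0∞ :=
  ∑ k ∈ Finset.range n, discount A l ω k * Aᶜ.indicator 1 (ω k).2 + discount A l ω n

lemma le_exitDiscount_of_jumpTime_le {A : Set V} {l : ℝ} (hl : 0 ≤ l) {ω : ℕ → ℝ≥0∞ × V}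
    {n : ℕ} {s : ℝ≥0∞} (hA : ∀ j < n, (ω j).2 ∈ A) (hn : jumpTime ω n ≤ s) :
    expNeg l s ≤ exitDiscount A l ω n := by
  refine le_trans ?_ (le_add_left le_rfl)
  rw [discount_eq_expNeg_jumpTime hA]
  exact expNeg_antitone hl hn

/-- No killing occurs before the first state outside `A`, whose jump time is at most `s`; the payoff
falls there or at jump `n`, whichever is earlier. -/
lemma le_exitDiscount_of_notMem {A : Set V} {l : ℝ} (hl : 0 ≤ l) {ω : ℕ → ℝ≥0∞ × V}
    {m : ℕ} {s : ℝ≥0∞} (hm : (ω m).2 ∉ A) (hs : jumpTime ω m ≤ s) (n : ℕ) :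
    expNeg l s ≤ exitDiscount A l ω n := by
  classical
  have hex : ∃ k, (ω k).2 ∉ A := ⟨m, hm⟩
  set k := Nat.find hex with hk
  have hkA : (ω k).2 ∉ A := Nat.find_spec hex
  have hlt : ∀ j < k, (ω j).2 ∈ A := fun j hj => not_not.1 (Nat.find_min hex hj)
  have hks : jumpTime ω k ≤ s := (jumpTime_mono ω (Nat.find_min' hex hm)).trans hs
  rcases lt_or_ge k n with hkn | hkn
  · refine le_trans ?_ (le_add_right le_rfl)
    refine le_trans ?_ (Finset.single_le_sum (fun _ _ => zero_le) (Finset.mem_range.2 hkn))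
    rw [Set.indicator_of_mem (by simpa using hkA), discount_eq_expNeg_jumpTime hlt]
    simpa using expNeg_antitone hl hks
  · exact le_exitDiscount_of_jumpTime_le hl (fun j hj => hlt j (by lia))
      ((jumpTime_mono ω hkn).trans hks)

lemma le_exitDiscount_of_path_notMem {A : Set V} {l : ℝ} (hl : 0 ≤ l) {ω : ℕ → ℝ≥0∞ × V}
    {s : ℝ≥0} (h : path ω s ∉ some '' A) (n : ℕ) : expNeg l s ≤ exitDiscount A l ω n := by
  classical
  by_cases hex : ∃ n, (s : ℝ≥0∞) < jumpTime ω (n + 1)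
  · rw [path, if_pos hex] at h
    set m := sInf {n : ℕ | (s : ℝ≥0∞) < jumpTime ω (n + 1)} with hmdef
    have hm : (ω m).2 ∉ A := fun hm => h ⟨_, hm, rfl⟩
    refine le_exitDiscount_of_notMem hl hm ?_ n
    rcases Nat.eq_zero_or_pos m with h0 | h0
    · simp [h0, jumpTime]
    -- Minimality of `m` means that the `m`-th jump has occurred by time `s`.
    · have : m - 1 ∉ {n : ℕ | (s : ℝ≥0∞) < jumpTime ω (n + 1)} :=
        Nat.notMem_of_lt_sInf (by lia)
      simpa [Nat.sub_add_cancel h0] using this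
  -- Cemetery case: all jump times are at most `s`, so the payoff at jump `n` suffices if the chain
  -- has not left `A` before.
  · push Not at hex
    by_cases hA : ∀ j < n, (ω j).2 ∈ A
    · exact le_exitDiscount_of_jumpTime_le hl hA
        ((jumpTime_mono ω (Nat.le_succ n)).trans (hex n))
    · push Not at hA
      obtain ⟨j, -, hj⟩ := hA
      exact le_exitDiscount_of_notMem hl hj ((jumpTime_mono ω (Nat.le_succ j)).trans (hex j)) n

/-- The strict inequality yields an actual time before `s` at which the path is outside `A`; the
infimum need not be attained. -/
lemma le_exitDiscount_of_exitTime_lt {A : Set V} {l : ℝ} (hl : 0 ≤ l) {ω : ℕ → ℝ≥0∞ × V}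
    {s : ℝ≥0∞} (h : exitTime A ω < s) (n : ℕ) : expNeg l s ≤ exitDiscount A l ω n := by
  simp only [exitTime, iInf_lt_iff] at h
  obtain ⟨t, -, ht, hts⟩ := h
  exact (expNeg_antitone hl hts.le).trans (le_exitDiscount_of_path_notMem hl ht n)

variable [MeasurableSpace V] [DiscreteMeasurableSpace V]

lemma measurable_discount (A : Set V) (l : ℝ) (n : ℕ) : Measurable (discount A l · n) := by
  unfold discount
  refine Finset.measurable_fun_prod _ fun j _ => ?_
  have h1 : Measurable (A.indicator (1 : V → ℝ≥0∞)) := Measurable.of_discrete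
  have h2 := measurable_expNeg l
  fun_prop

variable {q : V → V → ℝ≥0∞} {A : Set V} {l : ℝ} {g : V → ℝ≥0∞}

/-- Integrating out the last jump gives the recursion behind both the geometric decay (`g = 1`) and
the supermartingale bound. -/
lemma lintegral_discount_succ_mul (hl : 0 < l) (hq : ∀ z ∈ A, ∑' y, q z y ≠ ∞) (x : V)
    (g : V → ℝ≥0∞) (n : ℕ) :
    ∫⁻ ω, discount A l ω (n + 1) * g (ω (n + 1)).2 ∂(chainLaw q x)
      = ∫⁻ ω, discount A l ω n * A.indicator
          (fun z => (∑' y, q z y * g y) / (ENNReal.ofReal l + ∑' y, q z y)) (ω n).2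
          ∂(chainLaw q x) := by
  have hA : Measurable (A.indicator (1 : V → ℝ≥0∞)) := Measurable.of_discrete
  have hg : Measurable g := Measurable.of_discrete
  have hd := measurable_discount (V := V) A l n
  have he := measurable_expNeg l
  calc
    _ = ∫⁻ ω, (discount A l ω n * A.indicator 1 (ω n).2)
          * (expNeg l (ω (n + 1)).1 * g (ω (n + 1)).2) ∂(chainLaw q x) :=
      lintegral_congr fun ω => by rw [discount_succ]; ring
    _ = ∫⁻ ω, (discount A l ω n * A.indicator 1 (ω n).2)
          * ∫⁻ p, expNeg l p.1 * g p.2 ∂(stepLaw q (ω n).2) ∂(chainLaw q x) := by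
      refine lintegral_chainLaw_mul
        (F := fun ω => discount A l ω n * A.indicator 1 (ω n).2)
        (H := fun p => expNeg l p.1 * g p.2) (by fun_prop) (fun ω => ?_) (by fun_prop)
      simp only [min_self]
      rw [← discount_eq_min A l ω le_rfl]
    _ = _ := by
      refine lintegral_congr fun ω => ?_
      by_cases hz : (ω n).2 ∈ A
      · rw [lintegral_stepLaw (hq _ hz) hl, Set.indicator_of_mem hz, Set.indicator_of_mem hz]
        simp
      · rw [Set.indicator_of_notMem hz, Set.indicator_of_notMem hz]
        simp

lemma lintegral_discount_le_pow (hl : 0 < l) {c : ℝ≥0∞} (hq : ∀ z ∈ A, ∑' y, q z y ≠ ∞)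
    (hc : ∀ z ∈ A, (∑' y, q z y) / (ENNReal.ofReal l + ∑' y, q z y) ≤ c) (x : V) (n : ℕ) :
    ∫⁻ ω, discount A l ω n ∂(chainLaw q x) ≤ c ^ n := by
  induction n with
  | zero => simp [discount_zero]
  | succ n ih =>
    have h := lintegral_discount_succ_mul hl hq x (fun _ => 1) n
    simp only [mul_one] at h
    rw [h, pow_succ]
    refine le_trans (lintegral_mono (g := fun ω => discount A l ω n * c) fun ω => ?_) ?_
    · refine mul_le_mul_right ?_ _
      by_cases hz : (ω n).2 ∈ A
      · rw [Set.indicator_of_mem hz]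
        exact hc _ hz
      · simp [hz]
    · rw [lintegral_mul_const _ (measurable_discount A l n)]
      gcongr

/-- The left side is nonincreasing in `n` and equals `g x` at `n = 0`: inside `A` superharmonicity
applies, outside the payoff `1` is at most `g` and the later discount vanishes. -/
lemma lintegral_exitDiscount_superharmonic_le (hl : 0 < l) (hq : ∀ z ∈ A, ∑' y, q z y ≠ ∞)
    (hg : ∀ z ∈ A, ∑' y, q z y * g y ≤ (ENNReal.ofReal l + ∑' y, q z y) * g z)
    (hg1 : ∀ z ∉ A, 1 ≤ g z) (x : V) (n : ℕ) :
    ∑ k ∈ Finset.range n, ∫⁻ ω, discount A l ω k * Aᶜ.indicator 1 (ω k).2 ∂(chainLaw q x)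
      + ∫⁻ ω, discount A l ω n * g (ω n).2 ∂(chainLaw q x) ≤ g x := by
  have hg' : Measurable g := Measurable.of_discrete
  have hA : Measurable (Aᶜ.indicator (1 : V → ℝ≥0∞)) := Measurable.of_discrete
  induction n with
  | zero =>
    have h : ∫⁻ ω, g (ω 0).2 ∂(chainLaw q x) = g x := by
      rw [lintegral_congr_ae (g := fun _ => g x)]
      · simp
      · filter_upwards [ae_chainLaw_zero q x] with ω hω
        rw [hω]
    simp [discount_zero, h]
  | succ n ih =>
    refine le_trans ?_ ih
    have hd := measurable_discount (V := V) A l n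
    rw [Finset.sum_range_succ, add_assoc, lintegral_discount_succ_mul hl hq,
      ← lintegral_add_left (by fun_prop)]
    refine add_le_add le_rfl (lintegral_mono fun ω => ?_)
    by_cases hz : (ω n).2 ∈ A
    · simp only [Set.indicator_of_mem hz]
      rw [Set.indicator_of_notMem (by simpa using hz), mul_zero, zero_add]
      refine mul_le_mul_right (ENNReal.div_le_of_le_mul ?_) _
      rw [mul_comm]
      exact hg _ hz
    · rw [Set.indicator_of_mem (by simpa using hz), Set.indicator_of_notMem hz, mul_zero,
        add_zero]
      exact mul_le_mul_right (hg1 _ hz) _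

/-- An exit time estimate from a superharmonic function of the discounted chain. The bound `M` on
the total jump rates in `A` excludes an explosion inside of `A`. -/
theorem chainLaw_exitTime_lt_le {M : ℝ≥0∞} (hl : 0 < l) (hM : M ≠ ∞)
    (hq : ∀ z ∈ A, ∑' y, q z y ≤ M)
    (hg : ∀ z ∈ A, ∑' y, q z y * g y ≤ (ENNReal.ofReal l + ∑' y, q z y) * g z)
    (hg1 : ∀ z ∉ A, 1 ≤ g z) (x : V) (s : ℝ≥0∞) :
    expNeg l s * chainLaw q x {ω | exitTime A ω < s} ≤ g x := by
  have hq' : ∀ z ∈ A, ∑' y, q z y ≠ ∞ := fun z hz => ne_top_of_le_ne_top hM (hq z hz)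
  have hl0 : ENNReal.ofReal l ≠ 0 := by simpa using hl
  -- As `u ↦ u / (l + u)` is increasing, `c < 1` bounds every one-step discount in `A`.
  set c : ℝ≥0∞ := M / (ENNReal.ofReal l + M) with hcdef
  have hc1 : c < 1 := by
    rw [hcdef, ENNReal.div_lt_iff (by simp [hl0]) (by simp [hM]), one_mul, add_comm]
    exact ENNReal.lt_add_right hM hl0
  have hc : ∀ z ∈ A, (∑' y, q z y) / (ENNReal.ofReal l + ∑' y, q z y) ≤ c := by
    intro z hz
    rw [ENNReal.div_le_iff (by simp [hl0]) (by simp [hq' z hz]), hcdef, div_eq_mul_inv,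
      mul_right_comm, ← div_eq_mul_inv, ENNReal.le_div_iff_mul_le (by simp [hl0])
        (by simp [hM])]
    have := hq z hz
    calc (∑' y, q z y) * (ENNReal.ofReal l + M)
        = (∑' y, q z y) * ENNReal.ofReal l + M * ∑' y, q z y := by ring
      _ ≤ M * ENNReal.ofReal l + M * ∑' y, q z y := by gcongr
      _ = _ := by ring
  have hbound : ∀ n, expNeg l s * chainLaw q x {ω | exitTime A ω < s} ≤ g x + c ^ n := by
    intro n
    have hA : Measurable (Aᶜ.indicator (1 : V → ℝ≥0∞)) := Measurable.of_discrete
    have hd := fun k => measurable_discount (V := V) A l k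
    have hsum : Measurable fun ω : ℕ → ℝ≥0∞ × V =>
        ∑ k ∈ Finset.range n, discount A l ω k * Aᶜ.indicator 1 (ω k).2 := by fun_prop
    have hm : Measurable (exitDiscount A l · n) := by
      unfold exitDiscount
      exact hsum.add (hd n)
    calc expNeg l s * chainLaw q x {ω | exitTime A ω < s}
        -- Passing to a superlevel set of a measurable functional avoids measurability of the exit
        -- time.
        ≤ expNeg l s * chainLaw q x {ω | expNeg l s ≤ exitDiscount A l ω n} := by
          refine mul_le_mul_right (measure_mono fun ω hω => ?_) _
          exact le_exitDiscount_of_exitTime_lt hl.le hω n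
      _ ≤ ∫⁻ ω, exitDiscount A l ω n ∂(chainLaw q x) :=
          mul_meas_ge_le_lintegral hm _
      _ = ∑ k ∈ Finset.range n, ∫⁻ ω, discount A l ω k * Aᶜ.indicator 1 (ω k).2 ∂(chainLaw q x)
          + ∫⁻ ω, discount A l ω n ∂(chainLaw q x) := by
          unfold exitDiscount
          rw [lintegral_add_left hsum, lintegral_finsetSum _ fun k _ => by fun_prop]
      _ ≤ g x + c ^ n := by
          gcongr
          · exact le_trans (le_add_right le_rfl)
              (lintegral_exitDiscount_superharmonic_le hl hq' hg hg1 x n)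
          · exact lintegral_discount_le_pow hl hq' hc x n
  have hlim : Filter.Tendsto (fun n : ℕ => g x + c ^ n) Filter.atTop (nhds (g x + 0)) :=
    tendsto_const_nhds.add (ENNReal.tendsto_pow_atTop_nhds_zero_of_lt_one hc1)
  rw [add_zero] at hlim
  exact ge_of_tendsto' hlim hbound

end ExitTime

/-! ### The truncated distance as a barrier -/

namespace WeightedGraph

variable {V : Type*} [MeasurableSpace V] {d α cM cG : ℝ} {rG : EReal}

/-- The graph distance on scale `r`, truncated at `1`. -/
noncomputable def truncDist (Γ : WeightedGraph V d α cM cG rG) (r : ℝ) (x y : V) : ℝ≥0∞ :=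
  ENNReal.ofReal (min ((Γ.G.dist x y : ℝ) / r) 1)

lemma truncDist_self (Γ : WeightedGraph V d α cM cG rG) (r : ℝ) (x : V) :
    Γ.truncDist r x x = 0 := by simp [truncDist]

lemma truncDist_eq_one (Γ : WeightedGraph V d α cM cG rG) {r : ℝ} (hr : 0 < r) {x y : V}
    (h : y ∉ ball Γ.G x r) : Γ.truncDist r x y = 1 := by
  have h' : r < (Γ.G.dist x y : ℝ) := not_le.1 h
  rw [truncDist, min_eq_right ((one_le_div hr).2 h'.le), ENNReal.ofReal_one]

lemma truncDist_triangle (Γ : WeightedGraph V d α cM cG rG) {r : ℝ} (hr : 0 < r) (x y z : V) :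
    Γ.truncDist r x z ≤ Γ.truncDist r x y + Γ.truncDist r y z := by
  unfold truncDist
  rw [← ENNReal.ofReal_add (by positivity) (by positivity)]
  refine ENNReal.ofReal_le_ofReal ?_
  have h : (Γ.G.dist x z : ℝ) / r ≤ (Γ.G.dist x y : ℝ) / r + (Γ.G.dist y z : ℝ) / r := by
    rw [← add_div]
    gcongr
    exact_mod_cast Γ.connected.dist_triangle
  have h1 : 0 ≤ (Γ.G.dist x y : ℝ) / r := by positivity
  have h2 : 0 ≤ (Γ.G.dist y z : ℝ) / r := by positivity
  rcases min_cases ((Γ.G.dist x y : ℝ) / r) 1 with h3 | h3 <;>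
  rcases min_cases ((Γ.G.dist y z : ℝ) / r) 1 with h4 | h4 <;>
  rcases min_cases ((Γ.G.dist x z : ℝ) / r) 1 with h5 | h5 <;> linarith

/-- Short jumps are charged `ρ / r`, which lowers the exponent of `ρ` by one; long jumps are charged
`1`. The mass `μ_y` costs a factor `c_M`. -/
lemma rate_mul_truncDist_le (Γ : WeightedGraph V d α cM cG rG) {r : ℝ} (hr : 0 < r) (z y : V) :
    Γ.rate z y * Γ.truncDist r z y ≤ ENNReal.ofReal cM *
      (ENNReal.ofReal r⁻¹ * {y : V | (Γ.G.dist z y : ℝ) ≤ r}.indicator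
        (fun y => ENNReal.ofReal (Γ.w z y / (Γ.G.dist z y : ℝ) ^ (d + α - 1))) y
      + {y : V | r < (Γ.G.dist z y : ℝ)}.indicator
        (fun y => ENNReal.ofReal (Γ.w z y / (Γ.G.dist z y : ℝ) ^ (d + α))) y) := by
  unfold rate
  rw [mul_comm (ENNReal.ofReal _) (Γ.μ {y}), mul_assoc]
  refine mul_le_mul' (Γ.mass_le y) ?_
  have hw := Γ.w_nonneg z y
  have ht : Γ.truncDist r z y ≤ ENNReal.ofReal ((Γ.G.dist z y : ℝ) / r) :=
    ENNReal.ofReal_le_ofReal (min_le_left _ _)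
  rcases le_or_gt (Γ.G.dist z y : ℝ) r with h | h
  · refine le_trans ?_ (le_add_right le_rfl)
    rw [Set.indicator_of_mem (by exact h)]
    refine (mul_le_mul_right ht _).trans ?_
    rw [← ENNReal.ofReal_mul (by positivity), ← ENNReal.ofReal_mul (by positivity)]
    refine ENNReal.ofReal_le_ofReal (le_of_eq ?_)
    rcases eq_or_ne z y with rfl | hzy
    · simp [Γ.w_self]
    · have hpos : (0 : ℝ) < Γ.G.dist z y := by
        exact_mod_cast Γ.connected.pos_dist_of_ne hzy
      rw [Real.rpow_sub_one hpos.ne']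
      field_simp
  · refine le_trans ?_ (le_add_left le_rfl)
    rw [Set.indicator_of_mem (by exact h), truncDist_eq_one Γ hr (not_le.2 h), mul_one]

lemma tsum_rate_mul_truncDist_le (Γ : WeightedGraph V d α cM cG rG) {r : ℝ} (hr : 0 < r)
    (z : V) :
    ∑' y, Γ.rate z y * Γ.truncDist r z y
      ≤ ENNReal.ofReal cM * (ENNReal.ofReal r⁻¹ * Γ.firstMoment z r + Γ.tail z r) := by
  refine (ENNReal.tsum_le_tsum (Γ.rate_mul_truncDist_le hr z)).trans (le_of_eq ?_)
  rw [ENNReal.tsum_mul_left, ENNReal.tsum_add, ENNReal.tsum_mul_left, ← tsum_subtype,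
    ← tsum_subtype]
  rfl

/-- Distinct vertices are at distance at least `1`, so a jump has truncated size at least `1/r`.
This bounds the total jump rate in the ball by `r K`. -/
lemma rate_le_mul_truncDist (Γ : WeightedGraph V d α cM cG rG) {r : ℝ} (hr : 1 ≤ r) (z y : V) :
    Γ.rate z y ≤ ENNReal.ofReal r * (Γ.rate z y * Γ.truncDist r z y) := by
  rcases eq_or_ne z y with rfl | hzy
  · simp [rate, Γ.w_self]
  · have hpos : (1 : ℝ) ≤ Γ.G.dist z y := by
      exact_mod_cast Γ.connected.pos_dist_of_ne hzy
    have h : 1 ≤ ENNReal.ofReal r * Γ.truncDist r z y := by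
      rw [truncDist, ← ENNReal.ofReal_mul (by positivity), ENNReal.one_le_ofReal,
        mul_min_of_nonneg _ _ (by positivity), mul_div_cancel₀ _ (by positivity), mul_one]
      exact le_min hpos hr
    calc Γ.rate z y = Γ.rate z y * 1 := (mul_one _).symm
      _ ≤ Γ.rate z y * (ENNReal.ofReal r * Γ.truncDist r z y) := by gcongr
      _ = _ := by ring

/-- If the mean truncated displacement rate is at most `K` in a ball of radius `r`, then this ball
is left by time `t` with probability at most `e² K t`. -/
theorem chainLaw_exitTime_ball_le [DiscreteMeasurableSpace V] (Γ : WeightedGraph V d α cM cG rG)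
    {r K : ℝ} (hr : 1 ≤ r) {x : V}
    (h : ∀ z ∈ ball Γ.G x r, ∑' y, Γ.rate z y * Γ.truncDist r z y ≤ ENNReal.ofReal K)
    {t : ℝ} (ht : 0 < t) :
    chainLaw Γ.rate x {ω | exitTime (ball Γ.G x r) ω ≤ ENNReal.ofReal t}
      ≤ ENNReal.ofReal (Real.exp 2 * (K * t)) := by
  have hr0 : 0 < r := by linarith
  -- With `l = 1/t`, the constant `K t` in `g` contributes exactly `l · K t = K`, which absorbs the
  -- drift of the truncated distance.
  have key := chainLaw_exitTime_lt_le (q := Γ.rate) (A := ball Γ.G x r) (l := t⁻¹)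
    (g := fun y => Γ.truncDist r x y + ENNReal.ofReal (K * t))
    (M := ENNReal.ofReal r * ENNReal.ofReal K) (inv_pos.2 ht)
    (ENNReal.mul_ne_top ENNReal.ofReal_ne_top ENNReal.ofReal_ne_top)
    (fun z hz => by
      refine (ENNReal.tsum_le_tsum (Γ.rate_le_mul_truncDist hr z)).trans ?_
      rw [ENNReal.tsum_mul_left]
      exact mul_le_mul_right (h z hz) _)
    (fun z hz => by
      calc ∑' y, Γ.rate z y * (Γ.truncDist r x y + ENNReal.ofReal (K * t))
          ≤ ∑' y, (Γ.rate z y * Γ.truncDist r z y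
              + Γ.rate z y * (Γ.truncDist r x z + ENNReal.ofReal (K * t))) := by
            refine ENNReal.tsum_le_tsum fun y => ?_
            rw [← mul_add]
            refine mul_le_mul_right ?_ _
            refine (add_le_add_left (Γ.truncDist_triangle hr0 x z y) _).trans (le_of_eq ?_)
            ring
        _ = ∑' y, Γ.rate z y * Γ.truncDist r z y
              + (∑' y, Γ.rate z y) * (Γ.truncDist r x z + ENNReal.ofReal (K * t)) := by
            rw [ENNReal.tsum_add, ENNReal.tsum_mul_right]
        _ ≤ ENNReal.ofReal t⁻¹ * (Γ.truncDist r x z + ENNReal.ofReal (K * t))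
              + (∑' y, Γ.rate z y) * (Γ.truncDist r x z + ENNReal.ofReal (K * t)) := by
            refine add_le_add_left ((h z hz).trans ?_) _
            rw [mul_add, ← ENNReal.ofReal_mul (by positivity)]
            refine le_trans (le_of_eq ?_) (le_add_left le_rfl)
            congr 1
            field_simp
        _ = _ := by ring)
    (fun z hz => by
      rw [Γ.truncDist_eq_one hr0 hz]
      exact le_add_right le_rfl)
    -- Time `2t` turns `τ ≤ t` into a strict inequality; the discount `e^{-2}` there gives the
    -- factor `e²`.
    x (ENNReal.ofReal (2 * t))
  rw [truncDist_self, zero_add, expNeg_of_ne_top ENNReal.ofReal_ne_top,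
    ENNReal.toReal_ofReal (by positivity)] at key
  have he : t⁻¹ * (2 * t) = 2 := by field_simp
  rw [he] at key
  calc chainLaw Γ.rate x {ω | exitTime (ball Γ.G x r) ω ≤ ENNReal.ofReal t}
      ≤ chainLaw Γ.rate x {ω | exitTime (ball Γ.G x r) ω < ENNReal.ofReal (2 * t)} := by
        refine measure_mono fun ω (hω : exitTime _ ω ≤ _) => Set.mem_ofPred.2 (hω.trans_lt ?_)
        exact (ENNReal.ofReal_lt_ofReal_iff (by positivity)).2 (by linarith)
    _ = ENNReal.ofReal (Real.exp 2) * (ENNReal.ofReal (Real.exp (-2))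
          * chainLaw Γ.rate x {ω | exitTime (ball Γ.G x r) ω < ENNReal.ofReal (2 * t)}) := by
        rw [← mul_assoc, ← ENNReal.ofReal_mul (by positivity), ← Real.exp_add]
        simp
    _ ≤ ENNReal.ofReal (Real.exp 2) * ENNReal.ofReal (K * t) := by gcongr
    _ = _ := (ENNReal.ofReal_mul (by positivity)).symm

end WeightedGraph

end StableLike

/-! ### The exit time estimate -/

theorem propositionL (d α θ cM cG C₁ : ℝ) (hd : 0 < d) (hα : 0 < α) (hα1 : α < 1)
    (hθ : 0 < θ) (hθ1 : θ < 1) (hcM : 1 ≤ cM) (hcG : 1 ≤ cG) (hC₁ : 0 < C₁) :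
    ∃ C₂ : ℝ, 0 < C₂ ∧ ∀ R₀ : ℝ, 1 ≤ R₀ → ∃ R₁ : ℝ, R₀ < R₁ ∧
      ∀ (V : Type*) [MeasurableSpace V] [DiscreteMeasurableSpace V] (rG : EReal), 1 ≤ rG →
      ∀ (Γ : StableLike.WeightedGraph V d α cM cG rG) (o : V),
        (∀ R : ℝ, R₀ < R → (R : EReal) < rG → ∀ r : ℝ, R ^ θ / 2 ≤ r → r ≤ 2 * R →
          (⨆ x ∈ StableLike.ball Γ.G o (6 * R), Γ.firstMoment x r)
            ≤ ENNReal.ofReal (C₁ * r ^ (1 - α))) →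
        (∀ R : ℝ, R₀ < R → (R : EReal) < rG → ∀ r : ℝ, R ^ θ / 2 ≤ r →
          (⨆ x ∈ StableLike.ball Γ.G o (6 * R), Γ.tail x r)
            ≤ ENNReal.ofReal (C₁ * r ^ (-α))) →
        ∀ R : ℝ, R₁ < R → (R : EReal) < rG → ∀ x ∈ StableLike.ball Γ.G o (2 * R),
          ∀ r : ℝ, R ^ θ ≤ r → r ≤ R → ∀ t : ℝ, 0 < t →
            StableLike.chainLaw Γ.rate x
                {ω | StableLike.exitTime (StableLike.ball Γ.G x r) ω ≤ ENNReal.ofReal t}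
              ≤ ENNReal.ofReal (C₂ * t / r ^ α) := by
  -- The factor `2 C₁` adds the first-moment and tail bounds at scale `r`; any `R₁ > R₀` would do.
  refine ⟨Real.exp 2 * (cM * (2 * C₁)), by positivity, fun R₀ hR₀ => ⟨R₀ + 1, by linarith, ?_⟩⟩
  intro V _ _ rG _ Γ o hfirst htail R hR hRG x hx r hr hrR t ht
  have hRθ : 1 ≤ R ^ θ := Real.one_le_rpow (by linarith) hθ.le
  have hr1 : 1 ≤ r := hRθ.trans hr
  have hr0 : 0 < r := by linarith
  have hrα : 0 ≤ r ^ (-α) := by positivity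
  -- Since `r ≤ R`, the ball lies in `B(o, 3R)`, where both hypotheses hold at scale `r`.
  have hball : ∀ z ∈ StableLike.ball Γ.G x r, z ∈ StableLike.ball Γ.G o (6 * R) := by
    intro z hz
    have h1 : (Γ.G.dist o x : ℝ) ≤ 2 * R := hx
    have h2 : (Γ.G.dist x z : ℝ) ≤ r := hz
    have h3 : (Γ.G.dist o z : ℝ) ≤ Γ.G.dist o x + Γ.G.dist x z := by
      exact_mod_cast Γ.connected.dist_triangle
    change (Γ.G.dist o z : ℝ) ≤ 6 * R
    linarith
  refine (Γ.chainLaw_exitTime_ball_le (K := cM * (2 * (C₁ * r ^ (-α)))) hr1 (fun z hz => ?_) ht).trans (le_of_eq ?_)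
  · have h1 : Γ.firstMoment z r ≤ ENNReal.ofReal (C₁ * r ^ (1 - α)) :=
      (le_iSup₂_of_le z (hball z hz) le_rfl).trans
        (hfirst R (by linarith) hRG r (by linarith) (by linarith))
    have h2 : Γ.tail z r ≤ ENNReal.ofReal (C₁ * r ^ (-α)) :=
      (le_iSup₂_of_le z (hball z hz) le_rfl).trans
        (htail R (by linarith) hRG r (by linarith))
    calc _ ≤ _ := Γ.tsum_rate_mul_truncDist_le hr0 z
      _ ≤ ENNReal.ofReal cM * (ENNReal.ofReal r⁻¹ * ENNReal.ofReal (C₁ * r ^ (1 - α))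
          + ENNReal.ofReal (C₁ * r ^ (-α))) := by gcongr
      _ = _ := by
        rw [← ENNReal.ofReal_mul (by positivity), ← ENNReal.ofReal_add (by positivity)
          (by positivity), ← ENNReal.ofReal_mul (by positivity), sub_eq_add_neg,
          Real.rpow_add hr0, Real.rpow_one]
        congr 1
        field_simp
        ring
  · congr 1
    rw [Real.rpow_neg hr0.le]
    field_simp
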